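/- Let $\mathcal{E}$ be a category. Write $1$ for a terminal object; an element $x\in X$ is an arrow $x\colon 1\to X$; for $f\colon X\to Y$ and $y\in Y$ write $y\mathrel{\epsilon} f$ if $fx=y$ for some $x\in X$. An arrow $f\colon X\to Y$ is a surjection if $y\mathrel{\epsilon} f$ for every $y\in Y$, and $Y$ is a choice object if every surjection $f\colon X\to Y$ has a section. $\mathcal{E}$ is a model of CETCS if: (C1) it has finite limits and finite colimits; (C2) any arrows $Y\xrightarrow{g}X\xrightarrow{f}I$ have a universal dependent product; (C3) it has a natural numbers object; (C4) $1$ is separating (if $fx=gx$ for all $x\in X$ then $f=g\colon X\to Y$) and a strong generator ($f\colon X\to Y$ is an isomorphism whenever for every $y\in Y$ there is a unique $x\in X$ with $fx=y$); (C5) for every object $X$ there are a choice object $P$ and a surjection $P\to X$; (C6) the initial object has no elements; (C7) in any sum diagram $i\colon X\to S\leftarrow Y\colon j$, each $z\in S$ satisfies $z\mathrel{\epsilon} i$ or $z\mathrel{\epsilon} j$; (C8) in any sum diagram $i\colon 1\to S\leftarrow 1\colon j$, $i\neq j$; (C9) every arrow factors as a surjection followed by a mono; (C10) every equivalence relation is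 a kernel pair. Here a family of functional relations over $f,g$ is a pair of an arrow $h\colon J\to I$ and a mono $r\colon R\rightarrowtail J\times X\times Y$ such that for all $j\in J$, $x,x'\in X$, $y,y'\in Y$: $\langle j,x,y\rangle\mathrel{\epsilon} r$ implies $gy=x$; $fx=hj$ if and only if $\langle j,x,y\rangle\mathrel{\epsilon} r$ for some $y\in Y$; and $\langle j,x,y\rangle\mathrel{\epsilon} r$, $\langle j,x',y'\rangle\mathrel{\epsilon} r$, $x=x'$ imply $y=y'$. If $J=1$, then $h\in I$ is the domain index and $\langle r_2,r_3\rangle\colon R\to X\times Y$ is a functional relation. A universal dependent product for $f,g$ is a family of functional relations $\phi\colon F\to I$, $\alpha\colon P\rightarrowtail F\times X\times Y$ over $f,g$ such that for every functional relation $r\colon R\rightarrowtail X\times Y$ over $f,g$ with domain index $i$ there is a unique $c\in F$ with $\phi c=i$ and, for all $x\in X$, $y\in Y$, $\langle c,x,y\rangle\mathrel{\epsilon}\alpha$ if and only if $\langle x,y\rangle\mathrel{\epsilon} r$. A category $\mathcal{C}$ is weakly cartesian if it has finite products and weak equalisers (equalisers without the uniqueness of the universal arrow). For weakly cartesian $\mathcal{C}$,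 the exact completion $\mathcal{C}_{\mathrm{ex}}$ has as objects the pseudo-equivalence relations in $\mathcal{C}$, that is, the arrows $r=\langle r_1,r_2\rangle\colon R\to X\times X$ (not necessarily monic) for which there are $\rho\colon X\to R$ with $r\rho=\langle \mathrm{id},\mathrm{id}\rangle$, $\sigma\colon R\to R$ with $r\sigma=\langle r_2,r_1\rangle$, and $\tau\colon W\to R$ with $r\tau=\langle r_1p_1,r_2p_2\rangle$, where $p_1,p_2\colon W\to R$ is a weak pullback of $r_2$ and $r_1$. Arrows from $r\colon R\to X\times X$ to $s\colon S\to Y\times Y$ are equivalence classes of arrows $f\colon X\to Y$ for which there is $\hat f\colon R\to S$ with $s\hat f=(f\times f)r$, where $f$ and $g$ are equivalent if there is $h\colon X\to S$ with $sh=\langle f,g\rangle$. The functor $\Gamma\colon\mathcal{C}\to\mathcal{C}_{\mathrm{ex}}$ sends $X$ to the diagonal $X\to X\times X$. Corollary. Let $\mathcal{E}$ be a model of CETCS and let $\mathcal{P}$ be its full subcategory of choice objects. Then the choice objects are closed under finite products in $\mathcal{E}$, $\mathcal{P}$ is a weakly cartesian category, and $\mathcal{E}$ is the exact completion of $\mathcal{P}$: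 there is an equivalence of categories $\Phi\colon\mathcal{P}_{\mathrm{ex}}\to\mathcal{E}$ such that $\Phi\circ\Gamma$ is naturally isomorphic to the inclusion $\mathcal{P}\hookrightarrow\mathcal{E}$. -/

import Mathlib

open CategoryTheory CategoryTheory.Limits

universe v u

namespace CETCS

/-! ### Weakly cartesian categories -/

section WeakLimits

variable {C : Type u} [Category.{v} C]

/-- `e : E ⟶ X` is a weak equaliser of `f` and `g`: an equaliser, without the uniqueness of the
universal arrow. -/
def IsWeakEqualizer {E X Y : C} (e : E ⟶ X) (f g : X ⟶ Y) : Prop :=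
  e ≫ f = e ≫ g ∧ ∀ ⦃T : C⦄ (t : T ⟶ X), t ≫ f = t ≫ g → ∃ k : T ⟶ E, k ≫ e = t

/-- `p₁, p₂` is a weak pullback of `f` and `g`: a pullback, without the uniqueness of the
universal arrow. -/
def IsWeakPullback {P A B X : C} (p₁ : P ⟶ A) (p₂ : P ⟶ B) (f : A ⟶ X) (g : B ⟶ X) : Prop :=
  p₁ ≫ f = p₂ ≫ g ∧
    ∀ ⦃T : C⦄ (a : T ⟶ A) (b : T ⟶ B), a ≫ f = b ≫ g →
      ∃ k : T ⟶ P, k ≫ p₁ = a ∧ k ≫ p₂ = b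

variable (C) in
/-- A category is weakly cartesian if it has finite products and weak equalisers. -/
class WeaklyCartesian : Prop extends HasFiniteProducts C where
  exists_weakEqualizer : ∀ ⦃X Y : C⦄ (f g : X ⟶ Y),
    ∃ (E : C) (e : E ⟶ X), IsWeakEqualizer e f g

end WeakLimits

/-! ### Pseudo-equivalence relations and the exact completion of a weakly cartesian category -/

section Exact

variable {C : Type u} [Category.{v} C]

/-- The arrow `r : R ⟶ X ⨯ X`, with components `r₁` and `r₂`, is a pseudo-equivalence relation:
there are arrows witnessing reflexivity, symmetry and transitivity, the last of them defined on
a weak pullback of `r₂` and `r₁`. None of these arrows has to be unique. -/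
structure IsPseudoEquivRel [HasFiniteProducts C] {R X : C} (r : R ⟶ X ⨯ X) : Prop where
  refl : ∃ ρ : X ⟶ R, ρ ≫ r = diag X
  symm : ∃ σ : R ⟶ R, σ ≫ r = prod.lift (r ≫ prod.snd) (r ≫ prod.fst)
  trans : ∃ (W : C) (p₁ p₂ : W ⟶ R),
    IsWeakPullback p₁ p₂ (r ≫ prod.snd) (r ≫ prod.fst) ∧
      ∃ τ : W ⟶ R, τ ≫ r = prod.lift (p₁ ≫ r ≫ prod.fst) (p₂ ≫ r ≫ prod.snd)

variable (C) in
/-- Objects of the exact completion of `C`: the pseudo-equivalence relations in `C`. -/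
structure ExactCompletion [WeaklyCartesian C] where
  carrier : C
  rel : C
  r : rel ⟶ carrier ⨯ carrier
  isPseudoEquivRel : IsPseudoEquivRel r

namespace ExactCompletion

variable [WeaklyCartesian C]

/-- Arrows of `C` between the carriers that can be tracked by an arrow between the relations. -/
def PreHom (A B : ExactCompletion C) : Type v :=
  {f : A.carrier ⟶ B.carrier // ∃ f' : A.rel ⟶ B.rel, f' ≫ B.r = A.r ≫ prod.map f f}

/-- Two such arrows `f` and `g` are identified if `⟨f, g⟩` factors through the relation of the
codomain. -/
instance homSetoid (A B : ExactCompletion C) : Setoid (PreHom A B) where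
  r f g := ∃ h : A.carrier ⟶ B.rel, h ≫ B.r = prod.lift f.1 g.1
  iseqv :=
    { refl := by
        intro f
        obtain ⟨ρ, hρ⟩ := B.isPseudoEquivRel.refl
        refine ⟨f.1 ≫ ρ, ?_⟩
        rw [Category.assoc, hρ]
        ext <;> simp
      symm := by
        rintro f g ⟨h, hh⟩
        obtain ⟨σ, hσ⟩ := B.isPseudoEquivRel.symm
        refine ⟨h ≫ σ, ?_⟩
        rw [Category.assoc, hσ]
        ext <;> simp [reassoc_of% hh, prod.lift_fst, prod.lift_snd]
      trans := by
        rintro f g k ⟨h, hh⟩ ⟨l, hl⟩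
        obtain ⟨W, p₁, p₂, ⟨_, hW⟩, τ, hτ⟩ := B.isPseudoEquivRel.trans
        obtain ⟨t, ht₁, ht₂⟩ := hW h l (by simp [reassoc_of% hh, reassoc_of% hl, prod.lift_fst, prod.lift_snd])
        refine ⟨t ≫ τ, ?_⟩
        rw [Category.assoc, hτ]
        ext
        · simp [reassoc_of% ht₁, reassoc_of% hh, prod.lift_fst]
        · simp [reassoc_of% ht₂, reassoc_of% hl, prod.lift_snd] }

/-- The identity arrow of the carrier. -/
def PreHom.id (A : ExactCompletion C) : PreHom A A :=
  ⟨𝟙 _, 𝟙 _, by simp⟩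

/-- Composition of tracked arrows is composition in `C`. -/
def PreHom.comp {A B D : ExactCompletion C} (f : PreHom A B) (g : PreHom B D) : PreHom A D :=
  ⟨f.1 ≫ g.1, by
    obtain ⟨f', hf⟩ := f.2
    obtain ⟨g', hg⟩ := g.2
    refine ⟨f' ≫ g', ?_⟩
    rw [Category.assoc, hg, reassoc_of% hf]
    simp⟩

/-- Composition respects the identification of tracked arrows. -/
theorem PreHom.comp_congr {A B D : ExactCompletion C} {f₁ f₂ : PreHom A B} {g₁ g₂ : PreHom B D}
    (hf : f₁ ≈ f₂) (hg : g₁ ≈ g₂) : f₁.comp g₁ ≈ f₂.comp g₂ := by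
  refine Setoid.trans (b := f₁.comp g₂) ?_ ?_
  · obtain ⟨h, hh⟩ := hg
    refine ⟨f₁.1 ≫ h, ?_⟩
    rw [Category.assoc, hh]
    ext <;> simp [PreHom.comp]
  · obtain ⟨h, hh⟩ := hf
    obtain ⟨g', hg'⟩ := g₂.2
    refine ⟨h ≫ g', ?_⟩
    rw [Category.assoc, hg', reassoc_of% hh]
    ext <;> simp [PreHom.comp]

/-- The exact completion: arrows are equivalence classes of tracked arrows. -/
instance category : Category.{v} (ExactCompletion C) where
  Hom A B := Quotient (homSetoid A B)
  id A := Quotient.mk _ (PreHom.id A)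
  comp f g := Quotient.map₂ PreHom.comp
    (fun _ _ hf _ _ hg => PreHom.comp_congr hf hg) f g
  id_comp := by
    rintro A B ⟨f⟩
    exact congrArg (Quotient.mk _) (Subtype.ext (Category.id_comp _))
  comp_id := by
    rintro A B ⟨f⟩
    exact congrArg (Quotient.mk _) (Subtype.ext (Category.comp_id _))
  assoc := by
    rintro A B D E ⟨f⟩ ⟨g⟩ ⟨h⟩
    exact congrArg (Quotient.mk _) (Subtype.ext (Category.assoc _ _ _))

/-- The diagonal of an object is a pseudo-equivalence relation. -/
theorem isPseudoEquivRel_diag (X : C) : IsPseudoEquivRel (diag X) where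
  refl := ⟨𝟙 X, by simp⟩
  symm := ⟨𝟙 X, by ext <;> simp [prod.lift_fst, prod.lift_snd]⟩
  trans := ⟨X, 𝟙 X, 𝟙 X,
    ⟨by simp [prod.lift_fst, prod.lift_snd],
      fun T a b hab => ⟨a, by simp, by simpa [prod.lift_fst, prod.lift_snd] using hab⟩⟩,
    𝟙 X, by ext <;> simp [prod.lift_fst, prod.lift_snd]⟩

variable (C) in
/-- The canonical functor from `C` to its exact completion, which sends an object to its
diagonal. -/
noncomputable def embedding : C ⥤ ExactCompletion C where
  obj X := ⟨X, X, diag X, isPseudoEquivRel_diag X⟩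
  map f := Quotient.mk _ ⟨f, f, by ext <;> simp⟩
  map_id X := rfl
  map_comp f g := rfl

end ExactCompletion

end Exact

/-! ### Elements, surjections, choice objects and elementality -/

section Elements

variable {C : Type u} [Category.{v} C] [HasTerminal C]

/-- The (global) elements of an object. -/
abbrev Element (X : C) : Type v := ⊤_ C ⟶ X

/-- The element `y` of `Y` is in the image of `f`. -/
def Element.IsIn {X Y : C} (y : Element Y) (f : X ⟶ Y) : Prop :=
  ∃ x : Element X, x ≫ f = y

/-- An arrow is surjective if every element of its codomain is in its image. -/
def Surjection {X Y : C} (f : X ⟶ Y) : Prop :=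
  ∀ y : Element Y, y.IsIn f

variable (C) in
/-- Choice objects: every surjection onto the object has a section. -/
def choiceObjects : ObjectProperty C :=
  fun Y => ∀ ⦃X : C⦄ (f : X ⟶ Y), Surjection f → ∃ g : Y ⟶ X, g ≫ f = 𝟙 Y

variable (C) in
/-- A category with a terminal object is elemental if the terminal object is a strong generator
and is separating. -/
structure IsElemental : Prop where
  strongGenerator : ∀ ⦃X Y : C⦄ (f : X ⟶ Y),
    (∀ y : Element Y, ∃! x : Element X, x ≫ f = y) → IsIso f
  separating : ∀ ⦃X Y : C⦄ (f g : X ⟶ Y), (∀ x : Element X, x ≫ f = x ≫ g) → f = g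

/-- `N` with `zero` and `succ` is a natural numbers object. -/
def IsNaturalNumbersObject (N : C) (zero : Element N) (succ : N ⟶ N) : Prop :=
  ∀ ⦃X : C⦄ (x : Element X) (f : X ⟶ X),
    ∃! g : N ⟶ X, zero ≫ g = x ∧ succ ≫ g = g ≫ f

end Elements

/-! ### Equivalence relations and universal dependent products -/

section FiniteLimits

variable {C : Type u} [Category.{v} C] [HasFiniteLimits C]

/-- The arrow `r : R ⟶ X ⨯ X` is an equivalence relation in a category with finite limits. -/
structure IsEquivRel {R X : C} (r : R ⟶ X ⨯ X) : Prop where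
  mono : Mono r
  refl : ∃ ρ : X ⟶ R, ρ ≫ r = diag X
  symm : ∃ σ : R ⟶ R, σ ≫ r = prod.lift (r ≫ prod.snd) (r ≫ prod.fst)
  trans : ∃ τ : pullback (r ≫ prod.snd) (r ≫ prod.fst) ⟶ R,
    τ ≫ r = prod.lift
      (pullback.fst (r ≫ prod.snd) (r ≫ prod.fst) ≫ r ≫ prod.fst)
      (pullback.snd (r ≫ prod.snd) (r ≫ prod.fst) ≫ r ≫ prod.snd)

variable {X Y I : C} (f : X ⟶ I) (g : Y ⟶ X)

/-- The pair of `h : J ⟶ I` and the mono `r` into `J × X × Y` is a family of functional relations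
over `f, g`: it is a family of partial sections of `g`, it has domains indexed by `f`, and it is
functional. -/
structure IsFunctionalFamily {J R : C} (h : J ⟶ I) (r : R ⟶ J ⨯ (X ⨯ Y)) : Prop where
  mono : Mono r
  partialSection : ∀ (j : Element J) (x : Element X) (y : Element Y),
    Element.IsIn (prod.lift j (prod.lift x y)) r → y ≫ g = x
  domain : ∀ (j : Element J) (x : Element X),
    x ≫ f = j ≫ h ↔ ∃ y : Element Y, Element.IsIn (prod.lift j (prod.lift x y)) r
  functional : ∀ (j : Element J) (x x' : Element X) (y y' : Element Y),
    Element.IsIn (prod.lift j (prod.lift x y)) r →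
      Element.IsIn (prod.lift j (prod.lift x' y')) r → x = x' → y = y'

/-- The pair of `φ : F ⟶ I` and the mono `α` into `F × X × Y` is a universal dependent product
for `f, g`: it is a family of functional relations over `f, g`, and every functional relation
over `f, g` (a family indexed by the terminal object) with domain index `i` is the member of the
family at a unique element `c` of `F` over `i`. -/
structure IsUniversalDependentProduct {F P : C} (φ : F ⟶ I) (α : P ⟶ F ⨯ (X ⨯ Y)) : Prop where
  family : IsFunctionalFamily f g φ α
  universal : ∀ ⦃R : C⦄ (i : Element I) (r : R ⟶ (⊤_ C) ⨯ (X ⨯ Y)), IsFunctionalFamily f g i r →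
    ∃! c : Element F, c ≫ φ = i ∧ ∀ (x : Element X) (y : Element Y),
      Element.IsIn (prod.lift c (prod.lift x y)) α ↔
        Element.IsIn (prod.lift x y) (r ≫ prod.snd)

end FiniteLimits

/-! ### The axioms -/

/-- A model of the Constructive Elementary Theory of the Category of Sets. -/
class Model (E : Type u) [Category.{v} E] : Prop extends HasFiniteLimits E where
  /-- Together with the parent: finite limits and finite colimits exist. -/
  [hasFiniteColimits : HasFiniteColimits E]
  /-- Any pair of composable arrows has a universal dependent product. -/
  exists_dependentProduct : ∀ ⦃X Y I : E⦄ (f : X ⟶ I) (g : Y ⟶ X),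
    ∃ (F P : E) (φ : F ⟶ I) (α : P ⟶ F ⨯ (X ⨯ Y)), IsUniversalDependentProduct f g φ α
  /-- There is a natural numbers object. -/
  exists_nno : ∃ (N : E) (zero : Element N) (succ : N ⟶ N), IsNaturalNumbersObject N zero succ
  /-- Elementality. -/
  elemental : IsElemental E
  /-- Every object is the codomain of a surjection from a choice object. -/
  exists_choiceObject : ∀ X : E, ∃ (P : E) (p : P ⟶ X), choiceObjects E P ∧ Surjection p
  /-- The initial object has no elements. -/
  initial_empty : IsEmpty (Element (⊥_ E))
  /-- The terminal object is indecomposable. -/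
  indecomposable : ∀ ⦃X Y S : E⦄ (i : X ⟶ S) (j : Y ⟶ S),
    Nonempty (IsColimit (BinaryCofan.mk i j)) → ∀ z : Element S, z.IsIn i ∨ z.IsIn j
  /-- The two injections into a sum of two terminal objects are different. -/
  injections_ne : ∀ ⦃S : E⦄ (i j : ⊤_ E ⟶ S),
    Nonempty (IsColimit (BinaryCofan.mk i j)) → i ≠ j
  /-- Any arrow factors as a surjection followed by a mono. -/
  exists_factorization : ∀ ⦃X Y : E⦄ (f : X ⟶ Y),
    ∃ (M : E) (e : X ⟶ M) (m : M ⟶ Y), Surjection e ∧ Mono m ∧ e ≫ m = f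
  /-- Every equivalence relation is a kernel pair. -/
  effective : ∀ ⦃R X : E⦄ (r : R ⟶ X ⨯ X), IsEquivRel r →
    ∃ (Q : E) (q : X ⟶ Q), IsKernelPair q (r ≫ prod.fst) (r ≫ prod.snd)

/-- The full subcategory of choice objects. -/
abbrev ChoiceCategory (E : Type u) [Category.{v} E] [HasTerminal E] : Type u :=
  (choiceObjects E).FullSubcategory

end CETCS

namespace CETCS

attribute [local simp] prod.lift_fst prod.lift_snd prod.lift_fst_assoc prod.lift_snd_assoc
  pullback.lift_fst pullback.lift_snd pullback.lift_fst_assoc pullback.lift_snd_assoc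

/-! ### Lifting, descent and quotients, tested on elements -/

section Elements

variable {E : Type u} [Category.{v} E] [CETCS.Model E]

/-! By elementality, arrows are equal when they agree on elements and isomorphisms when they are
bijective on elements, so constructions can be checked pointwise. Choice objects are projective with
respect to surjections (`exists_lift_of_surjection`): pull the surjection back and split it. Every
object is covered by a choice object, and equivalence relations given on elements have quotients
with exactly the prescribed kernel (`exists_quotient`). The theorem is thus an instance of the fact
that an exact category with enough projectives, closed under finite products, is the exact
completion of these projectives.

The equivalence sends a pseudo-equivalence relation to its quotient in `E`. Projectivity turns
pointwise witnesses into arrows, so two arrows from a choice object are related if and only if the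
projection identifies them (`exists_lift_iff`); this gives both well-definedness and faithfulness.
Fullness is projectivity of the carrier. For essential surjectivity, an object is covered by a
choice object, and so is the kernel pair of that cover.

Closure under binary products (`choiceObjects_prod`) is where dependent products enter: they collect
the sections over the fibres into one object, from which a choice can be made uniformly. -/

theorem Surjection.epi {X Y : E} {q : X ⟶ Y} (hq : Surjection q) : Epi q where
  left_cancellation f g h := Model.elemental.separating f g fun y => by
    obtain ⟨x, rfl⟩ := hq y
    simp only [Category.assoc, h]

theorem Surjection.pullback_snd {X Y Z : E} {p : X ⟶ Z} (hp : Surjection p) (t : Y ⟶ Z) :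
    Surjection (pullback.snd p t) := fun y => by
  obtain ⟨x, hx⟩ := hp (y ≫ t)
  exact ⟨pullback.lift x y hx, by simp⟩

/-- Arrows out of a choice object lift through surjections. -/
theorem exists_lift_of_surjection {T P Y : E} (hT : choiceObjects E T) {p : P ⟶ Y}
    (hp : Surjection p) (t : T ⟶ Y) : ∃ k : T ⟶ P, k ≫ p = t := by
  obtain ⟨s, hs⟩ := hT _ (hp.pullback_snd t)
  exact ⟨s ≫ pullback.fst p t, by
    rw [Category.assoc, pullback.condition, reassoc_of% hs]⟩

/-- An arrow out of a choice object lifts through any arrow whose image contains its values. -/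
theorem exists_lift_of_forall_isIn {T P Y : E} (hT : choiceObjects E T) {p : P ⟶ Y} {t : T ⟶ Y}
    (h : ∀ z : Element T, Element.IsIn (z ≫ t) p) : ∃ k : T ⟶ P, k ≫ p = t := by
  obtain ⟨s, hs⟩ := hT (pullback.snd p t) fun z => by
    obtain ⟨x, hx⟩ := h z
    exact ⟨pullback.lift x z hx, by simp⟩
  exact ⟨s ≫ pullback.fst p t, by
    rw [Category.assoc, pullback.condition, reassoc_of% hs]⟩

/-- Joint version of `exists_lift_of_forall_isIn`. -/
theorem exists_pair_lift {T R X Y : E} (hT : choiceObjects E T) {r₁ : R ⟶ X} {r₂ : R ⟶ Y}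
    {a : T ⟶ X} {b : T ⟶ Y}
    (h : ∀ z : Element T, ∃ ρ : Element R, ρ ≫ r₁ = z ≫ a ∧ ρ ≫ r₂ = z ≫ b) :
    ∃ k : T ⟶ R, k ≫ r₁ = a ∧ k ≫ r₂ = b := by
  obtain ⟨k, hk⟩ := exists_lift_of_forall_isIn hT (p := prod.lift r₁ r₂) (t := prod.lift a b)
    fun z => by
      obtain ⟨ρ, h₁, h₂⟩ := h z
      exact ⟨ρ, by rw [prod.comp_lift, prod.comp_lift, h₁, h₂]⟩
  have h₁ := congrArg (· ≫ prod.fst) hk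
  have h₂ := congrArg (· ≫ prod.snd) hk
  exact ⟨k, by simpa using h₁, by simpa using h₂⟩

theorem isIso_of_injective_of_surjection {X Y : E} (f : X ⟶ Y)
    (hi : ∀ x x' : Element X, x ≫ f = x' ≫ f → x = x') (hs : Surjection f) : IsIso f :=
  Model.elemental.strongGenerator f fun y => by
    obtain ⟨x, rfl⟩ := hs y
    exact ⟨x, rfl, fun x' h => hi _ _ h⟩

/-- An arrow factors through a mono as soon as its values do. -/
theorem exists_lift_of_mono {T M Y : E} (m : M ⟶ Y) [Mono m] {t : T ⟶ Y}
    (h : ∀ z : Element T, Element.IsIn (z ≫ t) m) : ∃ k : T ⟶ M, k ≫ m = t := by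
  have : IsIso (pullback.snd m t) := isIso_of_injective_of_surjection _
    (fun x x' hx => (cancel_mono _).1 hx) fun z => by
      obtain ⟨x, hx⟩ := h z
      exact ⟨pullback.lift x z hx, by simp⟩
  exact ⟨inv (pullback.snd m t) ≫ pullback.fst m t, by
    rw [Category.assoc, pullback.condition, IsIso.inv_hom_id_assoc]⟩

/-- Surjections are quotients of their kernels. -/
theorem Surjection.exists_desc {X Q Z : E} {q : X ⟶ Q} (hq : Surjection q) (f : X ⟶ Z)
    (h : ∀ x x' : Element X, x ≫ q = x' ≫ q → x ≫ f = x' ≫ f) : ∃ g : Q ⟶ Z, q ≫ g = f := by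
  -- The image `M` of `⟨q, f⟩` is the graph of the required arrow: by `h` it is single-valued over
  -- `Q`, so its projection to `Q` is invertible.
  obtain ⟨M, e, m, he, hm, hem⟩ := Model.exists_factorization (prod.lift q f)
  have h₁ : e ≫ m ≫ prod.fst = q := by rw [reassoc_of% hem, prod.lift_fst]
  have h₂ : e ≫ m ≫ prod.snd = f := by rw [reassoc_of% hem, prod.lift_snd]
  have : IsIso (m ≫ prod.fst) := isIso_of_injective_of_surjection _ (fun z z' hz => by
      obtain ⟨x, rfl⟩ := he z
      obtain ⟨x', rfl⟩ := he z'
      simp only [Category.assoc, h₁] at hz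
      rw [← cancel_mono m]
      ext
      · simpa only [Category.assoc, h₁] using hz
      · simpa only [Category.assoc, h₂] using h _ _ hz) fun y => by
    obtain ⟨x, rfl⟩ := hq y
    exact ⟨x ≫ e, by rw [Category.assoc, h₁]⟩
  refine ⟨inv (m ≫ prod.fst) ≫ m ≫ prod.snd, ?_⟩
  conv_lhs => rw [← h₁]
  rw [← h₂]
  simp only [Category.assoc]
  rw [← Category.assoc m, IsIso.hom_inv_id_assoc]

/-- The pair of elements `x, x'` is related by the span `r₁, r₂`. -/
def SpanRel {R X : E} (r₁ r₂ : R ⟶ X) (x x' : Element X) : Prop :=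
  ∃ ρ : Element R, ρ ≫ r₁ = x ∧ ρ ≫ r₂ = x'

/-- The image of the span is a mono with the same related pairs. The arrows required of an
equivalence relation exist because lifting through a mono can be tested on elements, and effectivity
applies. -/
theorem exists_quotient {R X : E} (r₁ r₂ : R ⟶ X) (hr : Equivalence (SpanRel r₁ r₂)) :
    ∃ (Q : E) (q : X ⟶ Q), Surjection q ∧
      ∀ x x' : Element X, x ≫ q = x' ≫ q ↔ SpanRel r₁ r₂ x x' := by
  obtain ⟨M, e, m, he, hm, hem⟩ := Model.exists_factorization (prod.lift r₁ r₂)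
  have key (x x' : Element X) : Element.IsIn (prod.lift x x') m ↔ SpanRel r₁ r₂ x x' := by
    constructor
    · rintro ⟨y, hy⟩
      obtain ⟨ρ, rfl⟩ := he y
      rw [Category.assoc, hem] at hy
      have h₁ := congrArg (· ≫ prod.fst) hy
      have h₂ := congrArg (· ≫ prod.snd) hy
      exact ⟨ρ, by simpa using h₁, by simpa using h₂⟩
    · rintro ⟨ρ, rfl, rfl⟩
      exact ⟨ρ ≫ e, by rw [Category.assoc, hem, prod.comp_lift]⟩
  have mem (z : Element M) : SpanRel r₁ r₂ (z ≫ m ≫ prod.fst) (z ≫ m ≫ prod.snd) :=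
    (key _ _).1 ⟨z, by ext <;> simp⟩
  have hequiv : IsEquivRel m :=
    { mono := hm
      refl := exists_lift_of_mono m fun z => by
        simpa [diag] using (key _ _).2 (hr.refl z)
      symm := exists_lift_of_mono m fun z => by
        simpa using (key _ _).2 (hr.symm (mem z))
      trans := exists_lift_of_mono m fun z => by
        have h₁ := mem (z ≫ pullback.fst _ _)
        have h₂ := mem (z ≫ pullback.snd _ _)
        rw [Category.assoc, Category.assoc, pullback.condition] at h₁
        rw [Category.assoc, Category.assoc] at h₂
        simpa using (key _ _).2 (hr.trans h₁ h₂) }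
  obtain ⟨Q, q, hq⟩ := Model.effective m hequiv
  -- The arrow given by effectivity need not be surjective; its surjective part has the same kernel,
  -- since `m'` is mono.
  obtain ⟨Q', e', m', he', hm', rfl⟩ := Model.exists_factorization q
  refine ⟨Q', e', he', fun x x' => ?_⟩
  rw [← cancel_mono m', Category.assoc, Category.assoc, ← key]
  constructor
  · intro h
    exact ⟨hq.lift x x' h, by ext <;> simp⟩
  · rintro ⟨z, hz⟩
    have h₁ := congrArg (· ≫ prod.fst) hz
    have h₂ := congrArg (· ≫ prod.snd) hz
    simp only [Category.assoc, prod.lift_fst, prod.lift_snd] at h₁ h₂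
    have h := z ≫= hq.w
    rw [← h₁, ← h₂]
    simpa using h

/-! ### Finite products of choice objects -/

theorem choiceObjects_terminal {T : E} (hT : IsTerminal T) : choiceObjects E T := fun X f hf => by
  obtain ⟨x, -⟩ := hf (terminal.from _ ≫ (hT.from _))
  exact ⟨terminal.from T ≫ x, hT.hom_ext _ _⟩

/-- The graph of a partial section, defined on a fibre, is a functional relation. -/
theorem isFunctionalFamily_of_section {X Y I Q : E} (f : X ⟶ I) (g : Y ⟶ X) (i : Element I)
    (a : Q ⟶ X) (s : Q ⟶ Y) (hs : s ≫ g = a) (hmono : Mono a)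
    (ha : ∀ x : Element X, x ≫ f = i ↔ x.IsIn a) :
    IsFunctionalFamily f g i (prod.lift (terminal.from Q) (prod.lift a s)) := by
  have key (j : Element (⊤_ E)) (x : Element X) (y : Element Y) :
      Element.IsIn (prod.lift j (prod.lift x y))
        (prod.lift (terminal.from Q) (prod.lift a s)) ↔
      ∃ z : Element Q, z ≫ a = x ∧ z ≫ s = y := by
    constructor
    · rintro ⟨z, hz⟩
      have h₁ := congrArg (· ≫ prod.snd ≫ prod.fst) hz
      have h₂ := congrArg (· ≫ prod.snd ≫ prod.snd) hz
      exact ⟨z, by simpa using h₁, by simpa using h₂⟩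
    · rintro ⟨z, rfl, rfl⟩
      exact ⟨z, by ext <;> simp⟩
  refine ⟨⟨fun k l h => ?_⟩, fun j x y h => ?_, fun j x => ?_, fun j x x' y y' h h' hx => ?_⟩
  · have h₁ := congrArg (· ≫ prod.snd ≫ prod.fst) h
    exact (cancel_mono a).1 (by simpa using h₁)
  · obtain ⟨z, rfl, rfl⟩ := (key j x y).1 h
    rw [Category.assoc, hs]
  · simp only [key]
    rw [show j ≫ i = i from by rw [Subsingleton.elim j (𝟙 _), Category.id_comp], ha]
    constructor
    · rintro ⟨z, hz⟩
      exact ⟨z ≫ s, z, hz, rfl⟩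
    · rintro ⟨_, z, hz, _⟩
      exact ⟨z, hz⟩
  · obtain ⟨z, rfl, rfl⟩ := (key _ _ _).1 h
    obtain ⟨z', rfl, rfl⟩ := (key _ _ _).1 h'
    rw [(cancel_mono a).1 hx]

/-- Elements of the dependent product of `g` along `A ⨯ B ⟶ A` over `a` are sections of `g` over the
fibre `{a} × B`. They exist because `B` is a choice object; one is chosen for all `a` at once
because `A` is. -/
theorem choiceObjects_prod {A B : E} (hA : choiceObjects E A) (hB : choiceObjects E B) :
    choiceObjects E (A ⨯ B) := fun X g hg => by
  obtain ⟨F, P, φ, α, hα⟩ := Model.exists_dependentProduct (prod.fst : A ⨯ B ⟶ A) g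
  have hφ : Surjection φ := fun a => by
    let t : B ⟶ A ⨯ B := prod.lift (terminal.from B ≫ a) (𝟙 B)
    obtain ⟨s, hs⟩ := exists_lift_of_surjection hB hg t
    have hr := isFunctionalFamily_of_section (prod.fst : A ⨯ B ⟶ A) g a t s hs
      ⟨fun k l h => by simpa [t] using congrArg (· ≫ prod.snd) h⟩ fun x => by
        constructor
        · rintro rfl
          refine ⟨x ≫ prod.snd, ?_⟩
          ext
          · simp only [t, Category.assoc, prod.lift_fst]
            rw [← Category.assoc x, ← Category.assoc (x ≫ prod.snd),
              Subsingleton.elim ((x ≫ prod.snd) ≫ terminal.from B) (𝟙 _), Category.id_comp]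
          · simp [t]
        · rintro ⟨z, rfl⟩
          simp only [t, Category.assoc, prod.lift_fst]
          rw [← Category.assoc, Subsingleton.elim (z ≫ terminal.from B) (𝟙 _), Category.id_comp]
    obtain ⟨c, ⟨hc, -⟩, -⟩ := hα.universal a _ hr
    exact ⟨c, hc⟩
  obtain ⟨σ, hσ⟩ := hA φ hφ
  have := hα.family.mono
  -- The pullback of `α` along `w` glues the chosen fibrewise sections: it consists of the triples
  -- `((a, b), x)` with `⟨σ a, (a, b), x⟩` in `α`, the graph of a section of `g`.
  let w : (A ⨯ B) ⨯ X ⟶ F ⨯ ((A ⨯ B) ⨯ X) := prod.lift (prod.fst ≫ prod.fst ≫ σ) (𝟙 _)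
  let d : pullback α w ⟶ (A ⨯ B) ⨯ X := pullback.snd α w
  have mem (z : Element (pullback α w)) :
      Element.IsIn (prod.lift (z ≫ d ≫ prod.fst ≫ prod.fst ≫ σ)
        (prod.lift (z ≫ d ≫ prod.fst) (z ≫ d ≫ prod.snd))) α :=
    ⟨z ≫ pullback.fst α w, by
      rw [Category.assoc, pullback.condition]
      ext <;> simp [w, d]⟩
  have hiso : IsIso (d ≫ prod.fst) := by
    refine isIso_of_injective_of_surjection _ (fun z z' h => ?_) fun x => ?_
    · have h₁ := mem z
      have h₂ := mem z'
      rw [← reassoc_of% h, ← h] at h₂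
      have := hα.family.functional _ _ _ _ _ h₁ h₂ rfl
      have hmono : Mono d := inferInstanceAs (Mono (pullback.snd α w))
      rw [← cancel_mono d]
      ext1
      · simpa using h
      · simpa using this
    · obtain ⟨y, p, hp⟩ := (hα.family.domain (x ≫ prod.fst ≫ σ) x).1 (by simp [hσ])
      refine ⟨pullback.lift p (prod.lift x y) (by rw [hp]; ext <;> simp [w]), by simp [d]⟩
  refine ⟨inv (d ≫ prod.fst) ≫ d ≫ prod.snd, ?_⟩
  have : d ≫ prod.snd ≫ g = d ≫ prod.fst := by
    refine Model.elemental.separating _ _ fun z => ?_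
    simpa using hα.family.partialSection _ _ _ (mem z)
  rw [Category.assoc, Category.assoc, this, IsIso.inv_hom_id]

variable (E) in
theorem isClosedUnderFiniteProducts_choiceObjects :
    (choiceObjects E).IsClosedUnderFiniteProducts := by
  have hiso : (choiceObjects E).IsClosedUnderIsomorphisms := ⟨fun {X Y} e hX Z f hf => by
    obtain ⟨k, hk⟩ := exists_lift_of_surjection hX hf e.hom
    exact ⟨e.inv ≫ k, by rw [Category.assoc, hk, e.inv_hom_id]⟩⟩
  have h₀ : (choiceObjects E).IsClosedUnderLimitsOfShape (Discrete.{0} PEmpty) := ⟨by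
    rintro X ⟨p⟩
    exact choiceObjects_terminal ((IsLimit.equivOfNatIsoOfIso p.diag.uniqueFromEmpty _ _
        (by exact Cone.ext (Iso.refl _) (by rintro ⟨⟨⟩⟩))).1 p.isLimit)⟩
  have h₂ : (choiceObjects E).IsClosedUnderBinaryProducts := ⟨by
    rintro X ⟨p⟩
    refine (choiceObjects E).prop_of_iso ?_
      (choiceObjects_prod (p.prop_diag_obj ⟨.left⟩) (p.prop_diag_obj ⟨.right⟩))
    exact (HasLimit.isoOfNatIso (diagramIsoPair p.diag)).symm ≪≫
      (limit.isLimit p.diag).conePointUniqueUpToIso p.isLimit⟩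
  exact .mk'

end Elements

/-! ### The category of choice objects is weakly cartesian -/

section ChoiceCategory

variable (E : Type u) [Category.{v} E] [CETCS.Model E]

/-- A choice cover of the equaliser in `E` is a weak equaliser, since arrows from choice objects
lift through the cover, though not uniquely. -/
instance weaklyCartesian_choiceCategory : WeaklyCartesian (ChoiceCategory E) where
  toHasFiniteProducts :=
    have := isClosedUnderFiniteProducts_choiceObjects E
    inferInstance
  exists_weakEqualizer X Y f g := by
    obtain ⟨P, p, hP, hp⟩ := Model.exists_choiceObject (equalizer f.hom g.hom)
    refine ⟨⟨P, hP⟩, ObjectProperty.homMk (p ≫ equalizer.ι _ _), ?_, fun T t ht => ?_⟩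
    · ext
      change (p ≫ equalizer.ι f.hom g.hom) ≫ f.hom = (p ≫ equalizer.ι f.hom g.hom) ≫ g.hom
      rw [Category.assoc, Category.assoc, equalizer.condition]
    · obtain ⟨k, hk⟩ := exists_lift_of_surjection T.property hp
        (equalizer.lift t.hom (congrArg (·.hom) ht))
      exact ⟨ObjectProperty.homMk k, by ext; simp [reassoc_of% hk]⟩

end ChoiceCategory

/-! ### The comparison functor -/

theorem comp_eq_lift_iff {C : Type u} [Category.{v} C] [HasFiniteProducts C] {T R X Y : C}
    (k : T ⟶ R) (r : R ⟶ X ⨯ Y) (a : T ⟶ X) (b : T ⟶ Y) :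
    k ≫ r = prod.lift a b ↔ k ≫ r ≫ prod.fst = a ∧ k ≫ r ≫ prod.snd = b := by
  constructor
  · intro h
    rw [reassoc_of% h, reassoc_of% h, prod.lift_fst, prod.lift_snd]
    exact ⟨rfl, rfl⟩
  · rintro ⟨rfl, rfl⟩
    ext <;> simp [prod.lift_fst, prod.lift_snd]

namespace ExactCompletion

/-- The arrow of the exact completion represented by a tracked arrow. -/
def PreHom.toHom {C : Type u} [Category.{v} C] [WeaklyCartesian C] {A B : ExactCompletion C}
    (f : PreHom A B) : A ⟶ B :=
  Quotient.mk (homSetoid A B) f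

theorem PreHom.toHom_surjective {C : Type u} [Category.{v} C] [WeaklyCartesian C]
    {A B : ExactCompletion C} : Function.Surjective (PreHom.toHom (A := A) (B := B)) :=
  Quotient.mk_surjective

theorem PreHom.toHom_eq_iff {C : Type u} [Category.{v} C] [WeaklyCartesian C]
    {A B : ExactCompletion C} {f g : PreHom A B} :
    f.toHom = g.toHom ↔ ∃ h : A.carrier ⟶ B.rel, h ≫ B.r = prod.lift f.1 g.1 :=
  Quotient.eq

/-! ### Quotients of pseudo-equivalence relations and the quotient functor -/

variable {E : Type u} [Category.{v} E] [CETCS.Model E]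

/-- The first leg, in the ambient category, of a pseudo-equivalence relation. -/
noncomputable def src (A : ExactCompletion (ChoiceCategory E)) : A.rel.obj ⟶ A.carrier.obj :=
  (A.r ≫ prod.fst).hom

/-- The second leg, in the ambient category, of a pseudo-equivalence relation. -/
noncomputable def tgt (A : ExactCompletion (ChoiceCategory E)) : A.rel.obj ⟶ A.carrier.obj :=
  (A.r ≫ prod.snd).hom

/-- `A.r` lands in a product formed among the choice objects. Working with its legs avoids comparing
that product with the one in `E`. -/
theorem comp_r_eq_lift_iff (A : ExactCompletion (ChoiceCategory E)) {T : ChoiceCategory E}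
    (k : T ⟶ A.rel) (a b : T ⟶ A.carrier) :
    k ≫ A.r = prod.lift a b ↔ k.hom ≫ A.src = a.hom ∧ k.hom ≫ A.tgt = b.hom := by
  rw [comp_eq_lift_iff]
  exact and_congr ⟨congrArg InducedCategory.Hom.hom, fun h => ObjectProperty.hom_ext _ h⟩
    ⟨congrArg InducedCategory.Hom.hom, fun h => ObjectProperty.hom_ext _ h⟩

theorem equivalence_spanRel (A : ExactCompletion (ChoiceCategory E)) :
    Equivalence (SpanRel A.src A.tgt) where
  refl x := by
    obtain ⟨ρ, hρ⟩ := A.isPseudoEquivRel.refl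
    obtain ⟨h₁, h₂⟩ := (comp_r_eq_lift_iff _ _ _ _).1 hρ
    exact ⟨x ≫ ρ.hom, by simp [h₁], by simp [h₂]⟩
  symm := by
    rintro _ _ ⟨z, rfl, rfl⟩
    obtain ⟨σ, hσ⟩ := A.isPseudoEquivRel.symm
    obtain ⟨h₁, h₂⟩ := (comp_r_eq_lift_iff _ _ _ _).1 hσ
    exact ⟨z ≫ σ.hom, by rw [Category.assoc, h₁]; rfl, by rw [Category.assoc, h₂]; rfl⟩
  trans := by
    rintro _ _ _ ⟨z, rfl, rfl⟩ ⟨z', h, rfl⟩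
    obtain ⟨W, p₁, p₂, ⟨-, hW⟩, τ, hτ⟩ := A.isPseudoEquivRel.trans
    obtain ⟨h₁, h₂⟩ := (comp_r_eq_lift_iff _ _ _ _).1 hτ
    -- The terminal object is a choice object, so the weak pullback can be tested on elements.
    let T : ChoiceCategory E := ⟨⊤_ E, choiceObjects_terminal terminalIsTerminal⟩
    obtain ⟨k, hk₁, hk₂⟩ := hW (T := T) (ObjectProperty.homMk z) (ObjectProperty.homMk z')
      (ObjectProperty.hom_ext _ h.symm)
    obtain rfl : k.hom ≫ p₁.hom = z := congrArg (·.hom) hk₁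
    obtain rfl : k.hom ≫ p₂.hom = z' := congrArg (·.hom) hk₂
    exact ⟨k.hom ≫ τ.hom, by rw [Category.assoc, h₁]; simp [src],
      by rw [Category.assoc, h₂]; simp [tgt]⟩

/-- The quotient, in the ambient category, by a pseudo-equivalence relation. -/
noncomputable def quotient (A : ExactCompletion (ChoiceCategory E)) : E :=
  (exists_quotient A.src A.tgt A.equivalence_spanRel).choose

/-- The projection to the quotient by a pseudo-equivalence relation. -/
noncomputable def proj (A : ExactCompletion (ChoiceCategory E)) : A.carrier.obj ⟶ A.quotient :=
  (exists_quotient A.src A.tgt A.equivalence_spanRel).choose_spec.choose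

theorem surjection_proj (A : ExactCompletion (ChoiceCategory E)) : Surjection A.proj :=
  (exists_quotient A.src A.tgt A.equivalence_spanRel).choose_spec.choose_spec.1

instance epi_proj (A : ExactCompletion (ChoiceCategory E)) : Epi A.proj :=
  A.surjection_proj.epi

theorem comp_proj_eq_iff (A : ExactCompletion (ChoiceCategory E)) (x x' : Element A.carrier.obj) :
    x ≫ A.proj = x' ≫ A.proj ↔ SpanRel A.src A.tgt x x' :=
  (exists_quotient A.src A.tgt A.equivalence_spanRel).choose_spec.choose_spec.2 x x'

theorem src_proj (A : ExactCompletion (ChoiceCategory E)) : A.src ≫ A.proj = A.tgt ≫ A.proj :=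
  Model.elemental.separating _ _ fun z => by
    rw [← Category.assoc, ← Category.assoc, comp_proj_eq_iff]
    exact ⟨z, rfl, rfl⟩

/-- Arrows from a choice object are identified by the projection exactly if they are related. -/
theorem exists_lift_iff (A : ExactCompletion (ChoiceCategory E)) {T : ChoiceCategory E}
    (a b : T ⟶ A.carrier) :
    (∃ k : T ⟶ A.rel, k ≫ A.r = prod.lift a b) ↔ a.hom ≫ A.proj = b.hom ≫ A.proj := by
  simp only [comp_r_eq_lift_iff]
  constructor
  · rintro ⟨k, h₁, h₂⟩
    rw [← h₁, ← h₂, Category.assoc, Category.assoc, src_proj]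
  · intro h
    -- The witnesses for single elements assemble into one arrow because `T` is a choice object.
    obtain ⟨k, hk⟩ := exists_pair_lift T.property (r₁ := A.src) (r₂ := A.tgt) fun z => by
      have := (A.comp_proj_eq_iff (z ≫ a.hom) (z ≫ b.hom)).1 (by simp [h])
      exact this
    exact ⟨ObjectProperty.homMk k, hk⟩

theorem toHom_eq_iff {A B : ExactCompletion (ChoiceCategory E)} {f g : PreHom A B} :
    f.toHom = g.toHom ↔ f.1.hom ≫ B.proj = g.1.hom ≫ B.proj := by
  rw [PreHom.toHom_eq_iff, exists_lift_iff]

/-- An arrow between carriers is tracked exactly if it descends to the quotients. -/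
theorem exists_tracking_iff {A B : ExactCompletion (ChoiceCategory E)}
    (f : A.carrier ⟶ B.carrier) :
    (∃ f' : A.rel ⟶ B.rel, f' ≫ B.r = A.r ≫ prod.map f f) ↔
      ∃ g : A.quotient ⟶ B.quotient, A.proj ≫ g = f.hom ≫ B.proj := by
  -- Tracking `f` means relating its composites with the two legs of `A.r`. By `exists_lift_iff`
  -- this says that `f` followed by `B.proj` coequalises these legs.
  have h : A.r ≫ prod.map f f = prod.lift ((A.r ≫ prod.fst) ≫ f) ((A.r ≫ prod.snd) ≫ f) := by
    ext <;> simp [prod.lift_fst, prod.lift_snd]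
  rw [h, exists_lift_iff]
  change (A.src ≫ f.hom) ≫ B.proj = (A.tgt ≫ f.hom) ≫ B.proj ↔ _
  constructor
  · intro h
    refine A.surjection_proj.exists_desc _ fun x x' hx => ?_
    obtain ⟨z, rfl, rfl⟩ := (A.comp_proj_eq_iff _ _).1 hx
    simpa using z ≫= h
  · rintro ⟨g, hg⟩
    rw [Category.assoc, Category.assoc, ← hg, ← Category.assoc, src_proj, Category.assoc]

/-- Equivalent representatives agree after `B.proj`, so one `g` serves them all. -/
theorem exists_quotientMap {A B : ExactCompletion (ChoiceCategory E)} (F : A ⟶ B) :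
    ∃ g : A.quotient ⟶ B.quotient,
      ∀ f : PreHom A B, f.toHom = F → A.proj ≫ g = f.1.hom ≫ B.proj := by
  obtain ⟨f, rfl⟩ := PreHom.toHom_surjective F
  obtain ⟨g, hg⟩ := (exists_tracking_iff f.1).1 f.2
  exact ⟨g, fun f' h => by rw [hg, toHom_eq_iff.1 h]⟩

/-- The arrow between quotients induced by an arrow of the exact completion. -/
noncomputable def quotientMap {A B : ExactCompletion (ChoiceCategory E)} (F : A ⟶ B) :
    A.quotient ⟶ B.quotient :=
  (exists_quotientMap F).choose

theorem proj_quotientMap {A B : ExactCompletion (ChoiceCategory E)} (f : PreHom A B) :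
    A.proj ≫ quotientMap f.toHom = f.1.hom ≫ B.proj :=
  (exists_quotientMap f.toHom).choose_spec f rfl

variable (E) in
/-- The functor from the exact completion of the choice objects to the ambient category, which
sends a pseudo-equivalence relation to its quotient. -/
noncomputable def quotientFunctor : ExactCompletion (ChoiceCategory E) ⥤ E where
  obj A := A.quotient
  map F := quotientMap F
  map_id A := by
    rw [← cancel_epi A.proj, Category.comp_id]
    exact (proj_quotientMap (PreHom.id A)).trans (Category.id_comp _)
  map_comp {A B D} F G := by
    obtain ⟨f, rfl⟩ := PreHom.toHom_surjective F
    obtain ⟨g, rfl⟩ := PreHom.toHom_surjective G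
    rw [← cancel_epi A.proj, reassoc_of% proj_quotientMap f, proj_quotientMap g]
    exact (proj_quotientMap (f.comp g)).trans (Category.assoc _ _ _)

instance faithful_quotientFunctor : (quotientFunctor E).Faithful where
  map_injective {A B} F G h := by
    obtain ⟨f, rfl⟩ := PreHom.toHom_surjective F
    obtain ⟨g, rfl⟩ := PreHom.toHom_surjective G
    rw [toHom_eq_iff, ← proj_quotientMap, ← proj_quotientMap]
    exact A.proj ≫= h

/-- The carrier of `A` is a choice object, so `A.proj ≫ k` lifts through `B.proj`; the lift is
tracked because it descends to `k`. -/
instance full_quotientFunctor : (quotientFunctor E).Full where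
  map_surjective {A B} k := by
    obtain ⟨f, hf⟩ := exists_lift_of_surjection A.carrier.property B.surjection_proj (A.proj ≫ k)
    let f' : PreHom A B := ⟨ObjectProperty.homMk f, (exists_tracking_iff _).2 ⟨k, hf.symm⟩⟩
    exact ⟨f'.toHom, (cancel_epi A.proj).1 ((proj_quotientMap f').trans hf)⟩

/-! ### Essential surjectivity and the equivalence -/

/-- Every object of the ambient category is the quotient of a choice object by a
pseudo-equivalence relation. -/
theorem exists_presentation (Z : E) :
    ∃ (A : ExactCompletion (ChoiceCategory E)) (p : A.carrier.obj ⟶ Z), Surjection p ∧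
      ∀ x x' : Element A.carrier.obj, x ≫ p = x' ≫ p ↔ SpanRel A.src A.tgt x x' := by
  obtain ⟨X, p, hX, hp⟩ := Model.exists_choiceObject Z
  obtain ⟨R, c, hR, hc⟩ := Model.exists_choiceObject (pullback p p)
  let X' : ChoiceCategory E := ⟨X, hX⟩
  let R' : ChoiceCategory E := ⟨R, hR⟩
  let r₁ : R' ⟶ X' := ObjectProperty.homMk (c ≫ pullback.fst p p)
  let r₂ : R' ⟶ X' := ObjectProperty.homMk (c ≫ pullback.snd p p)
  have w : r₁.hom ≫ p = r₂.hom ≫ p := by simp [r₁, r₂, pullback.condition]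
  -- `R'` covers the kernel pair of `p`, so arrows from a choice object that `p` identifies are
  -- related. All three axioms reduce to this.
  have lift {T : ChoiceCategory E} (a b : T ⟶ X') (h : a.hom ≫ p = b.hom ≫ p) :
      ∃ k : T ⟶ R', k ≫ prod.lift r₁ r₂ = prod.lift a b := by
    obtain ⟨k, hk⟩ := exists_lift_of_surjection T.property hc (pullback.lift a.hom b.hom h)
    refine ⟨ObjectProperty.homMk k, ?_⟩
    rw [prod.comp_lift]
    congr 1
    · ext
      simp [r₁, reassoc_of% hk, pullback.lift_fst]
    · ext
      simp [r₂, reassoc_of% hk, pullback.lift_snd]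
  have hr : IsPseudoEquivRel (prod.lift r₁ r₂) :=
    { refl := lift _ _ rfl
      symm := lift _ _ (by simpa [prod.lift_fst, prod.lift_snd] using w.symm)
      trans := by
        -- A choice cover of the pullback in `E` is a weak pullback among choice objects.
        obtain ⟨W, e, hW, he⟩ := Model.exists_choiceObject (pullback r₂.hom r₁.hom)
        let p₁ : (⟨W, hW⟩ : ChoiceCategory E) ⟶ R' := ObjectProperty.homMk (e ≫ pullback.fst _ _)
        let p₂ : (⟨W, hW⟩ : ChoiceCategory E) ⟶ R' := ObjectProperty.homMk (e ≫ pullback.snd _ _)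
        have hw : p₁ ≫ r₂ = p₂ ≫ r₁ := by
          ext
          simp only [p₁, p₂, ObjectProperty.FullSubcategory.comp_hom, ObjectProperty.homMk_hom,
            Category.assoc, pullback.condition]
        simp only [prod.lift_fst, prod.lift_snd]
        refine ⟨⟨W, hW⟩, p₁, p₂, ⟨hw, fun T a b hab => ?_⟩, lift _ _ ?_⟩
        · obtain ⟨k, hk⟩ := exists_lift_of_surjection T.property he
            (pullback.lift a.hom b.hom (congrArg (·.hom) hab))
          refine ⟨ObjectProperty.homMk k, ?_, ?_⟩
          · ext
            simp [p₁, reassoc_of% hk, pullback.lift_fst]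
          · ext
            simp [p₂, reassoc_of% hk, pullback.lift_snd]
        · have hw' := congrArg (·.hom) hw
          simp only [ObjectProperty.FullSubcategory.comp_hom, Category.assoc] at hw' ⊢
          rw [w, reassoc_of% hw', w] }
  let A : ExactCompletion (ChoiceCategory E) := ⟨X', R', prod.lift r₁ r₂, hr⟩
  have h₁ : A.src = r₁.hom := congrArg (·.hom) (prod.lift_fst r₁ r₂)
  have h₂ : A.tgt = r₂.hom := congrArg (·.hom) (prod.lift_snd r₁ r₂)
  refine ⟨A, p, hp, fun x x' => ?_⟩
  rw [h₁, h₂]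
  constructor
  · intro h
    obtain ⟨ρ, hρ⟩ := hc (pullback.lift x x' h)
    exact ⟨ρ, by simp [r₁, reassoc_of% hρ, pullback.lift_fst],
      by simp [r₂, reassoc_of% hρ, pullback.lift_snd]⟩
  · rintro ⟨ρ, rfl, rfl⟩
    rw [Category.assoc, Category.assoc, w]

/-- `A.proj` and `p` are surjections from the same object with the same kernel, so the induced
comparison is bijective on elements. -/
instance essSurj_quotientFunctor : (quotientFunctor E).EssSurj where
  mem_essImage Z := by
    obtain ⟨A, p, hp, hA⟩ := exists_presentation Z
    obtain ⟨g, hg⟩ := A.surjection_proj.exists_desc p fun x x' h =>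
      (hA x x').2 ((A.comp_proj_eq_iff x x').1 h)
    have : IsIso g := isIso_of_injective_of_surjection g (fun z z' h => by
        obtain ⟨x, rfl⟩ := A.surjection_proj z
        obtain ⟨x', rfl⟩ := A.surjection_proj z'
        rw [Category.assoc, Category.assoc, hg] at h
        exact (A.comp_proj_eq_iff x x').2 ((hA x x').1 h)) fun y => by
      obtain ⟨x, rfl⟩ := hp y
      exact ⟨x ≫ A.proj, by rw [Category.assoc, hg]⟩
    exact ⟨A, ⟨(asIso g :)⟩⟩

instance isEquivalence_quotientFunctor : (quotientFunctor E).IsEquivalence where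

instance isIso_proj_embedding (X : ChoiceCategory E) :
    IsIso ((embedding (ChoiceCategory E)).obj X).proj := by
  refine isIso_of_injective_of_surjection _ (fun x x' h => ?_) (surjection_proj _)
  obtain ⟨z, rfl, rfl⟩ := (comp_proj_eq_iff _ _ _).1 h
  -- Both legs of the diagonal are identities, so related elements are equal and the projection is
  -- injective.
  obtain ⟨h₁, h₂⟩ := (comp_r_eq_lift_iff ((embedding (ChoiceCategory E)).obj X) (𝟙 X) (𝟙 X)
    (𝟙 X)).1 (Category.id_comp _)
  exact z ≫= ((Category.id_comp _).symm.trans (h₁.trans h₂.symm)).trans (Category.id_comp _)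

variable (E) in
/-- The quotient functor restricts to the inclusion of the choice objects. -/
noncomputable def embeddingCompQuotientFunctor :
    embedding (ChoiceCategory E) ⋙ quotientFunctor E ≅ (choiceObjects E).ι :=
  (NatIso.ofComponents
    (fun X => (asIso ((embedding (ChoiceCategory E)).obj X).proj :))
    (fun {X Y} f => (proj_quotientMap (A := (embedding (ChoiceCategory E)).obj X)
      (B := (embedding (ChoiceCategory E)).obj Y) ⟨f, f, by
        change f ≫ diag Y = diag X ≫ prod.map f f
        simp⟩).symm) :
    (choiceObjects E).ι ≅ embedding (ChoiceCategory E) ⋙ quotientFunctor E).symm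

end ExactCompletion

end CETCS

/-- In a model `E` of CETCS the choice objects are closed under finite products, the full
subcategory they form is weakly cartesian, and `E` is its exact completion: there is an
equivalence between the exact completion of the category of choice objects and `E` that carries
the canonical embedding to the inclusion. -/
theorem mainTheorem10 (E : Type u) [Category.{v} E] [CETCS.Model E] :
    (CETCS.choiceObjects E).IsClosedUnderFiniteProducts ∧
      ∃ _ : CETCS.WeaklyCartesian (CETCS.ChoiceCategory E),
        ∃ Φ : CETCS.ExactCompletion (CETCS.ChoiceCategory E) ≌ E,
          Nonempty (CETCS.ExactCompletion.embedding (CETCS.ChoiceCategory E) ⋙ Φ.functor ≅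
            (CETCS.choiceObjects E).ι) := by
  exact ⟨CETCS.isClosedUnderFiniteProducts_choiceObjects E,
    CETCS.weaklyCartesian_choiceCategory E,
    (CETCS.ExactCompletion.quotientFunctor E).asEquivalence,
    ⟨CETCS.ExactCompletion.embeddingCompQuotientFunctor E⟩⟩
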